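/- Let $d\ge 1$ and let $\Omega\subset\mathbb R^d$ be compact, such that $\Omega^\circ$ is a bounded Lipschitz domain and $\Omega$ is strictly star-shaped with respect to $0$, i.e. $\lambda x\in\Omega^\circ$ for all $x\in\Omega$, $0\le\lambda<1$. Let $1<\alpha<\frac{d}{d-1}$ (with $\frac{d}{d-1}=\infty$ for $d=1$) and $\alpha'=\frac{\alpha}{\alpha-1}$. For a compact set $K$ write $W^{1,p}(K)$ for the Sobolev space on $K^\circ$. Assume that for every $\nu\in W^{1,\alpha}(\Omega)^*$ with $\langle\nu,1\rangle=0$ there is a unique $y\in W^{1,\alpha'}(\Omega)$ with $\int_\Omega y\,dx=0$ and $-\int_\Omega\nabla y\cdot\nabla\phi\,dx=\langle\nu,\phi\rangle$ for all $\phi\in W^{1,\alpha}(\Omega)$. Let $w:\Omega\to[0,\infty)$ be continuous, let $s>0$, $\Omega_\varepsilon:=(1+s)\Omega$, and let $\hat w:\Omega_\varepsilon\to\mathbb R$ be a continuous extension of $w$ with $\min_{\Omega_\varepsilon}\hat w=\min_\Omega w$. Fix $\varepsilon>0$ and a functional $\nu\in\mathcal M_\perp:=\{\nu\in C^1(\Omega_\varepsilon)^*:\langle\nu,1\rangle=0\}$.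 For $\delta>0$, $x\in\Omega_\varepsilon$, $p\in\mathbb R^d$ put $$\mathcal G_{\varepsilon,\delta}(x,p)=\frac{\varepsilon}{\alpha'}\Big(\tfrac1\varepsilon\max\{|p|-\hat w(x),0\}\Big)^{\alpha'}+\delta\max\{|p|,\hat w(x)\}+\frac\delta2\min\Big\{\frac{|p|^2}{\hat w(x)},\hat w(x)\Big\}$$ (the last summand being $0$ where $\hat w(x)=0$), and let $\mathcal G^*_{\varepsilon,\delta}(x,\cdot)$ be the Fenchel conjugate of $\mathcal G_{\varepsilon,\delta}(x,\cdot)$. Let $\mathcal M(\Omega_\varepsilon)^d$ be the space of $\mathbb R^d$-valued Radon measures on $\Omega_\varepsilon$. Call $q\in\mathcal M(\Omega_\varepsilon)^d$ feasible if $q\ll\mathcal L^d$, $\frac{dq}{d\mathcal L^d}\in L^\alpha(\Omega_\varepsilon)^d$, and $\operatorname{div}\frac{dq}{d\mathcal L^d}=\nu$, which means that the functional $\phi\mapsto-\int_{\Omega_\varepsilon}\frac{dq}{d\mathcal L^d}\cdot\nabla\phi\,dx$ on $W^{1,\alpha'}(\Omega_\varepsilon)$ coincides with $\nu$ on $C^1(\Omega_\varepsilon)$.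 Define $$H^\delta_{\varepsilon,\nu}(q)=\int_{\Omega_\varepsilon}\mathcal G^*_{\varepsilon,\delta}\Big(x,\frac{dq}{d\mathcal L^d}(x)\Big)dx,\qquad H^0_{\varepsilon,\nu}(q)=\int_{\Omega_\varepsilon}\hat w\,d|q|+\frac\varepsilon\alpha\Big\|\frac{dq}{d\mathcal L^d}\Big\|_{L^\alpha(\Omega_\varepsilon)}^\alpha$$ for feasible $q$, and $H^\delta_{\varepsilon,\nu}(q)=H^0_{\varepsilon,\nu}(q)=+\infty$ otherwise. Then $H^\delta_{\varepsilon,\nu}$ $\Gamma$-converges to $H^0_{\varepsilon,\nu}$ as $\delta\to0$ with respect to weak-* convergence in $\mathcal M(\Omega_\varepsilon)^d$. That is, for every sequence $\delta_n>0$ with $\delta_n\to0$ and every $q\in\mathcal M(\Omega_\varepsilon)^d$: (i) $H^0_{\varepsilon,\nu}(q)\le\liminf_n H^{\delta_n}_{\varepsilon,\nu}(q_n)$ for every sequence $q_n$ converging weakly-* to $q$; (ii) there is a sequence $q_n$ converging weakly-* to $q$ with $\limsup_n H^{\delta_n}_{\varepsilon,\nu}(q_n)\le H^0_{\varepsilon,\nu}(q)$.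 -/

import Mathlib

open MeasureTheory Set Filter Topology TopologicalSpace
open scoped ENNReal NNReal ContDiff

noncomputable section

namespace Beckmann

/-- `ℝ^d` with the Euclidean norm. -/
abbrev E (d : ℕ) := EuclideanSpace ℝ (Fin d)

/-! ### Domains -/

/-- The boundary of `U` is Lipschitz: near each boundary point, in suitable orthogonal coordinates
`T` (with a distinguished coordinate `i`) and inside a box with half side lengths `a`, the set `U`
is the strict subgraph of a Lipschitz function `φ` of the other coordinates, and the boundary is
the graph of `φ`. -/
def HasLipschitzBoundary {d : ℕ} (U : Set (E d)) : Prop :=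
  ∀ x ∈ frontier U, ∃ (T : E d ≃ᵃⁱ[ℝ] E d) (a : Fin d → ℝ) (i : Fin d)
    (φ : ({j : Fin d // j ≠ i} → ℝ) → ℝ) (L : ℝ≥0),
    (∀ j, 0 < a j) ∧ (∀ j, |T x j| < a j) ∧
    LipschitzOnWith L φ {y | ∀ j, |y j| < a j} ∧
    (∀ y : {j : Fin d // j ≠ i} → ℝ, (∀ j, |y j| < a j) → |φ y| ≤ a i / 2) ∧
    ∀ z : E d, (∀ j, |T z j| < a j) →
      ((z ∈ U ↔ T z i < φ (fun j => T z j)) ∧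
        (z ∈ frontier U ↔ T z i = φ (fun j => T z j)))

/-- A bounded Lipschitz domain: nonempty, open, connected, bounded, with Lipschitz boundary. -/
def IsBoundedLipschitzDomain {d : ℕ} (U : Set (E d)) : Prop :=
  IsOpen U ∧ IsConnected U ∧ Bornology.IsBounded U ∧ HasLipschitzBoundary U

/-- Strict star-shapedness with respect to the origin. -/
def IsStrictlyStarShaped {d : ℕ} (K : Set (E d)) : Prop :=
  ∀ x ∈ K, ∀ t : ℝ, 0 ≤ t → t < 1 → t • x ∈ interior K

/-- The dilated compact set `(1 + s) K`. -/
def dilate {d : ℕ} (K : Compacts (E d)) (s : ℝ) : Compacts (E d) :=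
  K.map (fun x => (1 + s) • x) (continuous_const_smul (1 + s))

/-- The Lebesgue measure on (the Borel subsets of) a compact set `K`. -/
def leb {d : ℕ} (K : Compacts (E d)) : Measure K :=
  (volume : Measure (E d)).comap Subtype.val

lemma measurableSet_compacts {d : ℕ} (K : Compacts (E d)) :
    MeasurableSet {x : E d | x ∈ K} := K.isCompact.measurableSet

lemma integral_leb {d : ℕ} (K : Compacts (E d)) (f : E d → ℝ) :
    ∫ x, f x ∂(leb K) = ∫ x in (K : Set (E d)), f x :=
  integral_subtype_comap (measurableSet_compacts K) f

instance {d : ℕ} (K : Compacts (E d)) : IsFiniteMeasure (leb K) := by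
  constructor
  have h := comap_subtype_coe_apply (measurableSet_compacts K) (volume : Measure (E d)) univ
  refine lt_of_eq_of_lt h ?_
  exact (measure_mono (t := (K : Set (E d))) (by rintro _ ⟨x, -, rfl⟩; exact x.2)).trans_lt
    K.isCompact.measure_lt_top

/-! ### Continuously differentiable functions on `K`, and Sobolev functions -/

/-- `C¹(K)`: pairs of a continuous function on `K` and a continuous vector field on `K` which is its
gradient in the interior of `K`. As a subspace of `C(K, ℝ) × C(K, ℝ^d)` it carries the topology of
the `C¹`-norm. -/
def C1 {d : ℕ} (K : Compacts (E d)) : Submodule ℝ (C(K, ℝ) × C(K, E d)) where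
  carrier := {ψ | ∀ x : K, (x : E d) ∈ interior (K : Set (E d)) →
    HasGradientAt (Function.extend Subtype.val ψ.1 0) (ψ.2 x) (x : E d)}
  add_mem' := by
    intro a b ha hb x hx
    have h := (ha x hx).hasFDerivAt.add (hb x hx).hasFDerivAt
    rw [hasGradientAt_iff_hasFDerivAt]
    convert! h using 1
    · rw [← Function.extend_add]; simp
    · simp
  zero_mem' := by
    intro x _
    have h0 : Function.extend (Subtype.val : K → E d) (0 : K → ℝ) 0 = fun _ => 0 := by
      funext y
      by_cases hy : ∃ z : K, z.1 = y
      · obtain ⟨z, rfl⟩ := hy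
        rw [Subtype.val_injective.extend_apply]; rfl
      · rw [Function.extend_apply' _ _ _ hy]; rfl
    change HasGradientAt (Function.extend (Subtype.val : K → E d) (0 : K → ℝ) 0) 0 (x : E d)
    rw [h0]
    exact hasGradientAt_const _ _
  smul_mem' := by
    intro c a ha x hx
    have h := (ha x hx).hasFDerivAt.const_smul c
    rw [hasGradientAt_iff_hasFDerivAt]
    convert! h using 1
    · rw [← Function.extend_smul]; simp
    · simp

/-- The constant function `1` in `C¹(K)`. -/
def C1.one {d : ℕ} (K : Compacts (E d)) : C1 K :=
  ⟨(1, 0), by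
    intro x hx
    have h : HasGradientAt (fun _ : E d => (1 : ℝ)) 0 (x : E d) := hasGradientAt_const _ _
    refine h.congr_of_eventuallyEq ?_
    filter_upwards [mem_interior_iff_mem_nhds.1 hx] with y hy
    exact Subtype.val_injective.extend_apply _ _ (⟨y, hy⟩ : K)⟩

/-- The space `𝓜_⊥` of all continuous linear functionals `ν` on `C¹(K)` with `⟨ν, 1⟩ = 0`. -/
def MPerp {d : ℕ} (K : Compacts (E d)) : Submodule ℝ (StrongDual ℝ (C1 K)) where
  carrier := {ν | ν (C1.one K) = 0}
  add_mem' := by intro a b ha hb; simp_all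
  zero_mem' := by simp
  smul_mem' := by intro c a ha; simp_all

/-- `g` is a weak gradient of `u` in the interior of `K`. -/
def IsWeakGradient {d : ℕ} (K : Compacts (E d)) (u : K → ℝ) (g : K → E d) : Prop :=
  ∀ ζ : E d → ℝ, ContDiff ℝ ∞ ζ → HasCompactSupport ζ → tsupport ζ ⊆ interior (K : Set (E d)) →
    ∀ v : E d, ∫ x, u x * fderiv ℝ ζ x v ∂(leb K) = - ∫ x, inner ℝ (g x) v * ζ x ∂(leb K)


lemma integrable_mul_of_cont {d : ℕ} {K : Compacts (E d)} {f : K → ℝ}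
    (hf : Integrable f (leb K)) {h : E d → ℝ} (hh : Continuous h) (hc : HasCompactSupport h) :
    Integrable (fun x : K => f x * h x) (leb K) := by
  obtain ⟨C, hC⟩ := hh.bounded_above_of_compact_support hc
  exact hf.mul_bdd (c := C) (hh.comp continuous_subtype_val).aestronglyMeasurable
    (Eventually.of_forall fun x => hC x)

/-- The Sobolev space `W^{1,p}` on the interior of `K`: pairs of a function in `L^p` and its weak
gradient in `L^p`. (The boundary of a Lipschitz domain is a null set, so that `L^p(K)` and `L^p` of
the interior agree.) As a subspace of `L^p × L^p` it carries the usual topology. -/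
def Sobolev {d : ℕ} (K : Compacts (E d)) (p : ℝ≥0∞) [Fact (1 ≤ p)] :
    Submodule ℝ (Lp ℝ p (leb K) × Lp (E d) p (leb K)) where
  carrier := {u | IsWeakGradient K u.1 u.2}
  add_mem' := by
    intro a b ha hb ζ hζ hc hs v
    have ia := (Lp.memLp a.1).integrable (Fact.out : 1 ≤ p)
    have ib := (Lp.memLp b.1).integrable (Fact.out : 1 ≤ p)
    have ja := ((Lp.memLp a.2).integrable (Fact.out : 1 ≤ p)).inner_const (𝕜 := ℝ) v
    have jb := ((Lp.memLp b.2).integrable (Fact.out : 1 ≤ p)).inner_const (𝕜 := ℝ) v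
    have c1 : Continuous fun x => fderiv ℝ ζ x v :=
      (hζ.continuous_fderiv (by simp)).clm_apply continuous_const
    have c2 : HasCompactSupport fun x => fderiv ℝ ζ x v := hc.fderiv_apply ℝ v
    have e1 : ∫ x, (a + b).1 x * fderiv ℝ ζ x v ∂(leb K) =
        ∫ x, (a.1 x * fderiv ℝ ζ x v + b.1 x * fderiv ℝ ζ x v) ∂(leb K) := by
      refine integral_congr_ae ?_
      filter_upwards [Lp.coeFn_add a.1 b.1] with x hx
      rw [Prod.fst_add, hx, Pi.add_apply, add_mul]
    have e2 : ∫ x, inner ℝ ((a + b).2 x) v * ζ x ∂(leb K) =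
        ∫ x, (inner ℝ (a.2 x) v * ζ x + inner ℝ (b.2 x) v * ζ x) ∂(leb K) := by
      refine integral_congr_ae ?_
      filter_upwards [Lp.coeFn_add a.2 b.2] with x hx
      rw [Prod.snd_add, hx, Pi.add_apply, inner_add_left, add_mul]
    rw [e1, e2, integral_add (integrable_mul_of_cont ia c1 c2) (integrable_mul_of_cont ib c1 c2),
      integral_add (integrable_mul_of_cont ja hζ.continuous hc)
        (integrable_mul_of_cont jb hζ.continuous hc), ha ζ hζ hc hs v, hb ζ hζ hc hs v]
    ring
  zero_mem' := by
    intro ζ hζ hc hs v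
    have e1 : ∫ x, (0 : Lp ℝ p (leb K)) x * fderiv ℝ ζ x v ∂(leb K) = 0 := by
      refine integral_eq_zero_of_ae ?_
      filter_upwards [Lp.coeFn_zero ℝ p (leb K)] with x hx
      rw [hx, Pi.zero_apply, zero_mul]
    have e2 : ∫ x, inner ℝ ((0 : Lp (E d) p (leb K)) x) v * ζ x ∂(leb K) = 0 := by
      refine integral_eq_zero_of_ae ?_
      filter_upwards [Lp.coeFn_zero (E d) p (leb K)] with x hx
      rw [hx, Pi.zero_apply, inner_zero_left, zero_mul]
      rfl
    rw [Prod.fst_zero, Prod.snd_zero, e1, e2, neg_zero]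
  smul_mem' := by
    intro c a ha ζ hζ hc hs v
    have e1 : ∫ x, (c • a).1 x * fderiv ℝ ζ x v ∂(leb K) =
        ∫ x, c * (a.1 x * fderiv ℝ ζ x v) ∂(leb K) := by
      refine integral_congr_ae ?_
      filter_upwards [Lp.coeFn_smul c a.1] with x hx
      rw [Prod.smul_fst, hx, Pi.smul_apply, smul_eq_mul, mul_assoc]
    have e2 : ∫ x, inner ℝ ((c • a).2 x) v * ζ x ∂(leb K) =
        ∫ x, c * (inner ℝ (a.2 x) v * ζ x) ∂(leb K) := by
      refine integral_congr_ae ?_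
      filter_upwards [Lp.coeFn_smul c a.2] with x hx
      rw [Prod.smul_snd, hx, Pi.smul_apply, real_inner_smul_left, mul_assoc]
    rw [e1, e2, integral_const_mul, integral_const_mul, ha ζ hζ hc hs v]
    ring

/-- The gradient of a `C¹(K)` function is its weak gradient. -/
lemma C1.isWeakGradient {d : ℕ} {K : Compacts (E d)} (ψ : C1 K) :
    IsWeakGradient K ψ.1.1 ψ.1.2 := by
  intro ζ hζ hc hs v
  set f : E d → ℝ := Function.extend Subtype.val ψ.1.1 0 with hf
  set g : E d → E d := Function.extend Subtype.val ψ.1.2 0 with hg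
  have hfx : ∀ x : K, f x = ψ.1.1 x := fun x => Subtype.val_injective.extend_apply _ _ x
  have hgx : ∀ x : K, g x = ψ.1.2 x := fun x => Subtype.val_injective.extend_apply _ _ x
  have hder : ∀ x ∈ interior (K : Set (E d)), HasGradientAt f (g x) x := by
    intro x hx
    have := ψ.2 ⟨x, interior_subset hx⟩ hx
    rwa [← hgx ⟨x, interior_subset hx⟩] at this
  have hfd : ∀ x ∈ interior (K : Set (E d)), fderiv ℝ f x v = inner ℝ (g x) v := by
    intro x hx
    rw [(hder x hx).hasFDerivAt.fderiv]; simp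
  have hζ0 : ∀ x ∉ interior (K : Set (E d)), ζ x = 0 := fun x hx =>
    image_eq_zero_of_notMem_tsupport fun h => hx (hs h)
  have hζ1 : ∀ x ∉ interior (K : Set (E d)), fderiv ℝ ζ x v = 0 := fun x hx =>
    image_eq_zero_of_notMem_tsupport (f := fun y => fderiv ℝ ζ y v)
      fun h => hx (hs (tsupport_fderiv_apply_subset ℝ v h))
  have c1 : Continuous fun x => fderiv ℝ ζ x v :=
    (hζ.continuous_fderiv (by simp)).clm_apply continuous_const
  have c2 : HasCompactSupport fun x => fderiv ℝ ζ x v := hc.fderiv_apply ℝ v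
  have toOn : ∀ h : E d → ℝ, Integrable (fun x : K => h x) (leb K) →
      (∀ x ∉ interior (K : Set (E d)), h x = 0) → Integrable h := by
    intro h hi h0
    have : IntegrableOn h (K : Set (E d)) := by
      exact (integrableOn_iff_comap_subtypeVal (measurableSet_compacts K)).2 hi
    exact this.integrable_of_forall_notMem_eq_zero
      fun x hx => h0 x fun h => hx (interior_subset h)
  have toInt : ∀ h : E d → ℝ, (∀ x ∉ interior (K : Set (E d)), h x = 0) →
      ∫ x : K, h x ∂(leb K) = ∫ x, h x := by
    intro h h0
    rw [integral_leb]
    exact setIntegral_eq_integral_of_forall_compl_eq_zero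
      fun x hx => h0 x fun h => hx (interior_subset h)
  have iψ : Integrable (fun x : K => ψ.1.1 x) (leb K) :=
    ψ.1.1.continuous.integrable_of_hasCompactSupport (HasCompactSupport.of_compactSpace _)
  have ig : Integrable (fun x : K => (inner ℝ (ψ.1.2 x) v : ℝ)) (leb K) :=
    (ψ.1.2.continuous.inner continuous_const).integrable_of_hasCompactSupport
      (HasCompactSupport.of_compactSpace _)
  have i1 : Integrable (fun x => fderiv ℝ f x v * ζ x) := by
    have : (fun x => fderiv ℝ f x v * ζ x) = fun x => inner ℝ (g x) v * ζ x := by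
      funext x
      by_cases hx : x ∈ interior (K : Set (E d))
      · rw [hfd x hx]
      · rw [hζ0 x hx]; simp
    rw [this]
    refine toOn _ ?_ fun x hx => by rw [hζ0 x hx, mul_zero]
    simp only [hgx]
    exact integrable_mul_of_cont ig hζ.continuous hc
  have i2 : Integrable (fun x => f x * fderiv ℝ ζ x v) := by
    refine toOn _ ?_ fun x hx => by rw [hζ1 x hx, mul_zero]
    simp only [hfx]
    exact integrable_mul_of_cont iψ c1 c2
  have i3 : Integrable (fun x => f x * ζ x) := by
    refine toOn _ ?_ fun x hx => by rw [hζ0 x hx, mul_zero]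
    simp only [hfx]
    exact integrable_mul_of_cont iψ hζ.continuous hc
  have key := integral_mul_fderiv_eq_neg_fderiv_mul_of_integrable i1 i2 i3
    (fun x hx => (hder x (hs hx)).hasFDerivAt.differentiableAt)
    (fun x _ => (hζ.differentiable (by simp)) x)
  have e1 : ∫ x : K, ψ.1.1 x * fderiv ℝ ζ x v ∂(leb K) = ∫ x, f x * fderiv ℝ ζ x v := by
    rw [← toInt _ fun x hx => by rw [hζ1 x hx, mul_zero]]
    simp only [hfx]
  have e2 : ∫ x : K, inner ℝ (ψ.1.2 x) v * ζ x ∂(leb K) = ∫ x, fderiv ℝ f x v * ζ x := by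
    have : ∫ x, fderiv ℝ f x v * ζ x = ∫ x, inner ℝ (g x) v * ζ x := by
      refine integral_congr_ae (Eventually.of_forall fun x => ?_)
      by_cases hx : x ∈ interior (K : Set (E d))
      · simp only [hfd x hx]
      · simp only [hζ0 x hx, mul_zero]
    rw [this, ← toInt _ fun x hx => by rw [hζ0 x hx, mul_zero]]
    simp only [hgx]
  rw [e1, e2, key]

/-- The embedding of `C¹(K)` into `W^{1,p}`. -/
def C1.toSobolev {d : ℕ} {K : Compacts (E d)} (p : ℝ≥0∞) [Fact (1 ≤ p)] (ψ : C1 K) :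
    Sobolev K p :=
  ⟨(ContinuousMap.toLp p (leb K) ℝ ψ.1.1, ContinuousMap.toLp p (leb K) ℝ ψ.1.2), by
    intro ζ hζ hc hs v
    have h := C1.isWeakGradient ψ ζ hζ hc hs v
    have e1 : ∫ x, (ContinuousMap.toLp p (leb K) ℝ ψ.1.1) x * fderiv ℝ ζ x v ∂(leb K) =
        ∫ x : K, ψ.1.1 x * fderiv ℝ ζ x v ∂(leb K) := by
      refine integral_congr_ae ?_
      filter_upwards [ContinuousMap.coeFn_toLp (𝕜 := ℝ) (p := p) (leb K) ψ.1.1] with x hx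
      rw [hx]
    have e2 : ∫ x, inner ℝ ((ContinuousMap.toLp p (leb K) ℝ ψ.1.2) x) v * ζ x ∂(leb K) =
        ∫ x : K, inner ℝ (ψ.1.2 x) v * ζ x ∂(leb K) := by
      refine integral_congr_ae ?_
      filter_upwards [ContinuousMap.coeFn_toLp (𝕜 := ℝ) (p := p) (leb K) ψ.1.2] with x hx
      rw [hx]
    exact e1.trans (h.trans (by rw [e2]))⟩

/-! ### The divergence -/

/-- The functionals `ℓ` in the dual of `W^{1,p}` with `⟨ℓ, 1⟩ = 0`. For `p = α'` this is
`W^{-1,α}_⊥`. -/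
def WPerp {d : ℕ} (K : Compacts (E d)) (p : ℝ≥0∞) [Fact (1 ≤ p)] :
    Submodule ℝ (StrongDual ℝ (Sobolev K p)) where
  carrier := {l | l (C1.toSobolev p (C1.one K)) = 0}
  add_mem' := by intro a b ha hb; simp_all
  zero_mem' := by simp
  smul_mem' := by intro c a ha; simp_all

/-- The divergence of `q ∈ L^p(K; ℝ^d)`, that is, the functional `φ ↦ - ∫ q · ∇φ` on `W^{1,p'}`,
where `p'` is the conjugate exponent; it annihilates the constants. -/
def wdiv {d : ℕ} {K : Compacts (E d)} {p p' : ℝ≥0∞} [Fact (1 ≤ p)] [Fact (1 ≤ p')]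
    [ENNReal.HolderConjugate p p'] (q : Lp (E d) p (leb K)) : WPerp K p' :=
  ⟨-(((innerSL ℝ).lpPairing (leb K) p p' q).comp
      ((ContinuousLinearMap.snd ℝ (Lp ℝ p' (leb K)) (Lp (E d) p' (leb K))).comp
        (Sobolev K p').subtypeL)), by
    have h : (C1.toSobolev p' (C1.one K)).1.2 = 0 :=
      map_zero (ContinuousMap.toLp (E := E d) p' (leb K) ℝ)
    change -(((innerSL ℝ).lpPairing (leb K) p p' q) (C1.toSobolev p' (C1.one K)).1.2) = 0
    rw [h, map_zero, neg_zero]⟩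

lemma wdiv_apply {d : ℕ} {K : Compacts (E d)} {p p' : ℝ≥0∞} [Fact (1 ≤ p)] [Fact (1 ≤ p')]
    [ENNReal.HolderConjugate p p'] (q : Lp (E d) p (leb K)) (φ : Sobolev K p') :
    (wdiv q : WPerp K p').1 φ = - ∫ x, inner ℝ (q x) (φ.1.2 x) ∂(leb K) := by
  change -(((innerSL ℝ).lpPairing (leb K) p p' q) φ.1.2) = _
  rw [ContinuousLinearMap.lpPairing_eq_integral]
  rfl

/-- The exponent `α` as an extended nonnegative real. -/
abbrev ex (α : ℝ) : ℝ≥0∞ := ENNReal.ofReal α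
/-- The conjugate exponent `α' = α / (α - 1)` as an extended nonnegative real. -/
abbrev ex' (α : ℝ) : ℝ≥0∞ := ENNReal.ofReal (α / (α - 1))

instance (α : ℝ) [h : Fact (1 < α)] : Fact (1 ≤ ex α) :=
  ⟨by simpa using h.out.le⟩

instance (α : ℝ) [h : Fact (1 < α)] : Fact (1 ≤ ex' α) :=
  ⟨by
    have : (1 : ℝ) ≤ α / (α - 1) := (Real.HolderConjugate.conjExponent h.out).symm.lt.le
    simpa using this⟩

instance (α : ℝ) [h : Fact (1 < α)] : ENNReal.HolderConjugate (ex α) (ex' α) :=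
  (Real.HolderConjugate.conjExponent h.out).ennrealOfReal

instance (α : ℝ) [h : Fact (1 < α)] : ENNReal.HolderConjugate (ex' α) (ex α) :=
  (Real.HolderConjugate.conjExponent h.out).symm.ennrealOfReal

/-- For every `ν ∈ W^{-1,α'}_⊥` the equation `div ∇y = ν` has a unique solution `y ∈ W^{1,α'}` with
zero mean. -/
def NeumannSolvable {d : ℕ} (K : Compacts (E d)) (α : ℝ) [Fact (1 < α)] : Prop :=
  ∀ ν : WPerp K (ex α), ∃! y : Sobolev K (ex' α),
    ∫ x, y.1.1 x ∂(leb K) = 0 ∧ (wdiv y.1.2 : WPerp K (ex α)) = ν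

/-- `div q = ν` in `W^{-1,α}_⊥`, for `ν ∈ 𝓜_⊥`: the functional `ν` on `C¹(K)` is the restriction of
an element of `W^{-1,α}_⊥`, and this element is `div q`. -/
def DivEq {d : ℕ} {K : Compacts (E d)} {α : ℝ} [Fact (1 < α)] (q : Lp (E d) (ex α) (leb K))
    (ν : MPerp K) : Prop :=
  ∃ l : WPerp K (ex' α), (∀ ψ : C1 K, l.1 (C1.toSobolev (ex' α) ψ) = ν.1 ψ) ∧ wdiv q = l

/-! ### Vector measures -/

/-- Weak-* convergence of `ℝ^d`-valued measures on `K`: convergence of the integrals against all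
continuous vector fields. -/
def WeakStarTendsto {d : ℕ} {K : Compacts (E d)} (q : ℕ → VectorMeasure K (E d))
    (q₀ : VectorMeasure K (E d)) : Prop :=
  ∀ φ : C(K, E d), Tendsto (fun n => (q n).integral φ (innerSL ℝ)) atTop
    (𝓝 (q₀.integral φ (innerSL ℝ)))

/-- The `i`-th component of a vector measure. -/
def component {d : ℕ} {K : Compacts (E d)} (q : VectorMeasure K (E d)) (i : Fin d) :
    SignedMeasure K :=
  q.mapRange (EuclideanSpace.proj i : E d →L[ℝ] ℝ).toLinearMap.toAddMonoidHom
    (EuclideanSpace.proj i : E d →L[ℝ] ℝ).continuous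

/-- The Radon-Nikodym derivative of a vector measure with respect to Lebesgue measure. -/
def dens {d : ℕ} {K : Compacts (E d)} (q : VectorMeasure K (E d)) : K → E d :=
  fun x => WithLp.toLp 2 fun i => (component q i).rnDeriv (leb K) x

/-- Feasibility: `q` is absolutely continuous with density in `L^α`, and the divergence of the
density is `ν`. -/
def Feasible {d : ℕ} {K : Compacts (E d)} (α : ℝ) [Fact (1 < α)] (ν : MPerp K)
    (q : VectorMeasure K (E d)) : Prop :=
  VectorMeasure.AbsolutelyContinuous q (leb K).toENNRealVectorMeasure ∧
    ∃ h : MemLp (dens q) (ex α) (leb K), DivEq h.toLp ν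

/-! ### The integrands and the functionals -/

/-- The integrand `𝓕`, where `c` is the value of the cost at the point considered. -/
def calF {d : ℕ} (α ε c : ℝ) (p : E d) : ℝ :=
  ε / (α / (α - 1)) * (1 / ε * max (‖p‖ - c) 0) ^ (α / (α - 1))

/-- The Huber term `𝓡`, where `c` is the value of the cost at the point considered. For `c = 0` the
last summand is `0`, in accordance with `0 ≤ min {|p|²/c, c} ≤ c` for `c > 0`. -/
def calR {d : ℕ} (δ c : ℝ) (p : E d) : ℝ :=
  δ * max ‖p‖ c + δ / 2 * min (‖p‖ ^ 2 / c) c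

/-- The integrand `𝓖 = 𝓕 + 𝓡`. -/
def calG {d : ℕ} (α ε δ c : ℝ) (p : E d) : ℝ := calF α ε c p + calR δ c p

/-- The Fenchel conjugate of `𝓖` in `p`. The supremum is finite, as `𝓖` grows superlinearly. -/
def calGStar {d : ℕ} (α ε δ c : ℝ) (q : E d) : ℝ :=
  ⨆ p : E d, (inner ℝ q p - calG α ε δ c p)

open Classical in
/-- The Huber-regularized functional, for the cost `w`. -/
def H {d : ℕ} {K : Compacts (E d)} (α : ℝ) [Fact (1 < α)] (w : E d → ℝ) (ε δ : ℝ) (ν : MPerp K)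
    (q : VectorMeasure K (E d)) : EReal :=
  if Feasible α ν q then ((∫ x, calGStar α ε δ (w x) (dens q x) ∂(leb K) : ℝ) : EReal) else ⊤

open Classical in
/-- The `L^α`-regularized Beckmann functional, for the cost `w`. -/
def HZero {d : ℕ} {K : Compacts (E d)} (α : ℝ) [Fact (1 < α)] (w : E d → ℝ) (ε : ℝ) (ν : MPerp K)
    (q : VectorMeasure K (E d)) : EReal :=
  if Feasible α ν q then
    (((∫ x, w x ∂q.variation) + ε / α * (eLpNorm (dens q) (ex α) (leb K)).toReal ^ α : ℝ) : EReal)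
  else ⊤

/-- Sequential `Γ`-convergence of functionals `F n` to `F₀`, with respect to a notion `conv` of
convergence of sequences. -/
def GammaTendsto {X : Type*} (conv : (ℕ → X) → X → Prop) (F : ℕ → X → EReal) (F₀ : X → EReal) :
    Prop :=
  (∀ (x : X) (u : ℕ → X), conv u x → F₀ x ≤ liminf (fun n => F n (u n)) atTop) ∧
    ∀ x : X, ∃ u : ℕ → X, conv u x ∧ limsup (fun n => F n (u n)) atTop ≤ F₀ x

end Beckmann

end

/-! The regularization only raises the integrand: `calR` is nonnegative, so conjugation gives
`calGStar` ≤ `c‖q‖ + ε/α ‖q‖^α`, the density of `HZero`. The constant sequence is therefore a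
recovery sequence (`H_le_HZero`).

The lower bound rests on duality. For a continuous field `φ`, Fenchel-Young bounds the pairing of
`q_n` with `φ` by the regularized energy plus `∫ 𝓕(x, φ)` plus an error of order `δ_n` that depends
only on `φ` and `w` (`Feasible.integral_le`). If the energies stay below `M` along a subsequence,
weak-* convergence yields `⟨q, φ⟩ ≤ M + ∫ 𝓕(x, φ)` for every continuous `φ`.

This dual bound alone recovers the energy of `q`. It extends to bounded measurable fields by almost
everywhere approximation (`integral_le_of_forall_continuous`). Fields supported on a Lebesgue null
set cost nothing in `𝓕`, so `q` is absolutely continuous (`absolutelyContinuous_of_integral_le`).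
Truncations of the pointwise optimal dual field give `∫ (w‖f‖ + ε/α ‖f‖^α) ≤ M` for the density `f`
(`integrable_energy_of_integral_le`). The divergence constraint is tested only against gradients
that are continuous on the compact set, so it is weak-* closed. -/

namespace Beckmann

/-! ### Vector measures with a density -/

/-- A vector measure with values in `ℝ^d` has finite variation. -/
lemma isFiniteMeasure_variation {X : Type*} [MeasurableSpace X] {d : ℕ}
    (q : VectorMeasure X (E d)) : IsFiniteMeasure q.variation := by
  let c : Fin d → SignedMeasure X := fun i =>
    q.mapRange (EuclideanSpace.proj i : E d →L[ℝ] ℝ).toLinearMap.toAddMonoidHom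
      (EuclideanSpace.proj i : E d →L[ℝ] ℝ).continuous
  have hle : q.variation ≤ ∑ i, (c i).variation := by
    -- The Euclidean norm is at most the sum of the absolute coordinates, and each coordinate is a
    -- signed measure, whose total variation is finite by the Jordan decomposition.
    refine VectorMeasure.variation_le_of_forall_enorm_le fun s _ => ?_
    have h : ‖q s‖ₑ ≤ ∑ i, ‖q s i‖ₑ := by
      have h1 : q s = ∑ i, EuclideanSpace.single i (q s i) := by
        ext j
        simp
      calc ‖q s‖ₑ = ‖∑ i, EuclideanSpace.single i (q s i)‖ₑ := by rw [← h1]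
        _ ≤ ∑ i, ‖EuclideanSpace.single i (q s i)‖ₑ := enorm_sum_le _ _
        _ = ∑ i, ‖q s i‖ₑ := by
          refine Finset.sum_congr rfl fun i _ => ?_
          rw [← ofReal_norm, ← ofReal_norm, PiLp.norm_single]
    refine h.trans ?_
    rw [Measure.finsetSum_apply]
    exact Finset.sum_le_sum fun i _ => VectorMeasure.enorm_measure_le_variation (c i) s
  have (i : Fin d) : IsFiniteMeasure (c i).variation := by
    rw [← SignedMeasure.totalVariation_eq_variation]
    unfold SignedMeasure.totalVariation
    infer_instance
  exact isFiniteMeasure_of_le _ hle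

section Pairing

variable {X F : Type*} [MeasurableSpace X] [NormedAddCommGroup F] [InnerProductSpace ℝ F]
  [CompleteSpace F] {μ : Measure X} {g : X → F}

lemma isFiniteMeasure_variation_withDensityᵥ (hg : Integrable g μ) :
    IsFiniteMeasure (μ.withDensityᵥ g).variation := by
  rw [Measure.variation_withDensityᵥ hg]
  exact isFiniteMeasure_withDensity hg.2.ne

/-- Integration of simple functions against a vector measure with density `g`. -/
lemma integral_withDensityᵥ_simpleFunc (hg : Integrable g μ) (f : SimpleFunc X F) :
    (μ.withDensityᵥ g).integral f (innerSL ℝ) = ∫ x, inner ℝ (f x) (g x) ∂μ := by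
  have := isFiniteMeasure_variation_withDensityᵥ hg
  have hi (f : SimpleFunc X F) : Integrable (fun x => (inner ℝ (f x) (g x) : ℝ)) μ := by
    obtain ⟨C, hC⟩ := f.exists_forall_norm_le
    refine (hg.norm.const_mul C).mono' (f.aestronglyMeasurable.inner hg.aestronglyMeasurable)
      (Eventually.of_forall fun x => ?_)
    exact (norm_inner_le_norm _ _).trans (mul_le_mul_of_nonneg_right (hC x) (norm_nonneg _))
  have hv (f : SimpleFunc X F) : Integrable f (μ.withDensityᵥ g).variation :=
    SimpleFunc.integrable_of_isFiniteMeasure f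
  induction f using SimpleFunc.induction with
  | const c hs =>
    rename_i s
    have hfun : (⇑(SimpleFunc.piecewise s hs (SimpleFunc.const X c) (SimpleFunc.const X 0)) : X → F)
        = s.indicator fun _ => c := by
      ext x
      by_cases hx : x ∈ s <;> simp [SimpleFunc.piecewise_apply, hx]
    have h2 : (fun x => (inner ℝ (s.indicator (fun _ => c) x) (g x) : ℝ)) =
        s.indicator fun x => inner ℝ c (g x) := by
      funext x
      by_cases hx : x ∈ s <;> simp [hx]
    rw [hfun, VectorMeasure.integral_indicator hs, h2, integral_indicator hs,
      integral_inner hg.integrableOn]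
    have : IsFiniteMeasure ((μ.withDensityᵥ g).restrict s).variation := inferInstance
    rw [VectorMeasure.integral_const, VectorMeasure.restrict_apply _ hs MeasurableSet.univ,
      univ_inter, withDensityᵥ_apply hg hs]
    rfl
  | add hd h1 h2 =>
    rename_i f₁ f₂
    rw [SimpleFunc.coe_add]
    simp only [Pi.add_apply, inner_add_left]
    rw [integral_add (hi f₁) (hi f₂), ← h1, ← h2]
    exact VectorMeasure.integral_add (hv f₁) (hv f₂)

/-- Integration of bounded functions against a vector measure with density `g`. -/
lemma integral_withDensityᵥ (hg : Integrable g μ) {f : X → F} (hf : StronglyMeasurable f)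
    {C : ℝ} (hC : ∀ x, ‖f x‖ ≤ C) :
    (μ.withDensityᵥ g).integral f (innerSL ℝ) = ∫ x, inner ℝ (f x) (g x) ∂μ := by
  have := isFiniteMeasure_variation_withDensityᵥ hg
  -- A point of `X` is needed to conclude `0 ≤ C`, without which the truncated approximations are
  -- not bounded by `C`.
  rcases isEmpty_or_nonempty X with hX | ⟨⟨x₀⟩⟩
  · simp [Measure.eq_zero_of_isEmpty μ, VectorMeasure.integral_of_isEmpty]
  have hC0 : 0 ≤ C := (norm_nonneg _).trans (hC x₀)
  have hn (n : ℕ) (x : X) : ‖hf.approxBounded C n x‖ ≤ C :=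
    hf.norm_approxBounded_le hC0 n x
  have hlim (x : X) : Tendsto (fun n => hf.approxBounded C n x) atTop (𝓝 (f x)) :=
    hf.tendsto_approxBounded_of_norm_le (hC x)
  have h1 : Tendsto (fun n => (μ.withDensityᵥ g).integral (hf.approxBounded C n) (innerSL ℝ))
      atTop (𝓝 ((μ.withDensityᵥ g).integral f (innerSL ℝ))) :=
    VectorMeasure.tendsto_integral_filter_of_norm_le_const
      (Eventually.of_forall fun n => (hf.approxBounded C n).aestronglyMeasurable)
      ⟨C, Eventually.of_forall fun n => Eventually.of_forall (hn n)⟩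
      (Eventually.of_forall hlim)
  have h2 : Tendsto (fun n => ∫ x, (inner ℝ (hf.approxBounded C n x) (g x) : ℝ) ∂μ)
      atTop (𝓝 (∫ x, inner ℝ (f x) (g x) ∂μ)) := by
    refine tendsto_integral_of_dominated_convergence (fun x => C * ‖g x‖)
      (fun n => (hf.approxBounded C n).aestronglyMeasurable.inner hg.aestronglyMeasurable)
      (hg.norm.const_mul C) (fun n => Eventually.of_forall fun x => ?_)
      (Eventually.of_forall fun x => (hlim x).inner tendsto_const_nhds)
    exact (norm_inner_le_norm _ _).trans (mul_le_mul_of_nonneg_right (hn n x) (norm_nonneg _))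
  simp only [integral_withDensityᵥ_simpleFunc hg] at h1
  exact tendsto_nhds_unique h1 h2

end Pairing

/-- A bounded measurable function on a compact metric space is the almost everywhere limit of
continuous functions with the same bound. -/
lemma exists_continuous_tendsto_ae {X F : Type*} [TopologicalSpace X] [NormalSpace X]
    [MeasurableSpace X] [BorelSpace X] [NormedAddCommGroup F] [NormedSpace ℝ F]
    [SecondCountableTopologyEither X F] {m : Measure X} [IsFiniteMeasure m] [m.WeaklyRegular] {φ : X → F} (hφ : StronglyMeasurable φ)
    {C : ℝ} (hC : 0 < C) (hb : ∀ x, ‖φ x‖ ≤ C) :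
    ∃ ψ : ℕ → C(X, F), (∀ n x, ‖ψ n x‖ ≤ C) ∧
      ∀ᵐ x ∂m, Tendsto (fun n => ψ n x) atTop (𝓝 (φ x)) := by
  have hi : MemLp φ 1 m := MemLp.of_bound hφ.aestronglyMeasurable C (Eventually.of_forall hb)
  have h (n : ℕ) := hi.exists_boundedContinuous_eLpNorm_sub_le (ε := ((n : ℝ≥0∞) + 1)⁻¹)
    ENNReal.one_ne_top (by simp)
  choose g hg hgi using h
  have hm : TendstoInMeasure m (fun n => (g n : X → F)) atTop φ := by
    refine tendstoInMeasure_of_tendsto_eLpNorm one_ne_zero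
      (fun n => (g n).continuous.aestronglyMeasurable) hφ.aestronglyMeasurable ?_
    refine tendsto_of_tendsto_of_tendsto_of_le_of_le tendsto_const_nhds
      (h := fun n : ℕ => ((n : ℝ≥0∞) + 1)⁻¹) ?_ (fun n => zero_le) fun n => ?_
    · have := (tendsto_add_atTop_iff_nat 1).2 ENNReal.tendsto_inv_nat_nhds_zero
      simpa using this
    · rw [eLpNorm_sub_comm]
      exact hg n
  obtain ⟨ns, -, hns⟩ := hm.exists_seq_tendsto_ae
  -- `L¹` density loses the uniform bound. The radial retraction onto the closed ball of radius `C`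
  -- restores it, and being continuous and the identity on that ball it keeps the limit.
  let T : F → F := fun x => (C / max C ‖x‖) • x
  have hpos (x : F) : 0 < max C ‖x‖ := lt_max_of_lt_left hC
  have hT : Continuous T :=
    (continuous_const.div (continuous_const.max continuous_norm) fun x => (hpos x).ne').smul
      continuous_id
  have hTn (x : F) : ‖T x‖ ≤ C := by
    rw [norm_smul, Real.norm_of_nonneg (div_nonneg hC.le (hpos x).le), div_mul_eq_mul_div,
      div_le_iff₀ (hpos x)]
    exact mul_le_mul_of_nonneg_left (le_max_right _ _) hC.le
  have hTx (x : F) (hx : ‖x‖ ≤ C) : T x = x := by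
    simp [T, max_eq_left hx, hC.ne']
  refine ⟨fun n => ⟨fun x => T (g (ns n) x), hT.comp (g (ns n)).continuous⟩,
    fun n x => hTn _, ?_⟩
  filter_upwards [hns] with x hx
  have := (hT.tendsto (φ x)).comp hx
  rwa [hTx _ (hb x)] at this

/-! ### The density of a vector measure on a compact set -/

section Density

variable {d : ℕ} {K : Compacts (E d)}

lemma measurable_dens (q : VectorMeasure K (E d)) : Measurable (dens q) :=
  (WithLp.measurable_toLp 2 _).comp
    (measurable_pi_lambda _ fun _ => SignedMeasure.measurable_rnDeriv _ _)

lemma integrable_dens (q : VectorMeasure K (E d)) : Integrable (dens q) (leb K) := by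
  refine ⟨(measurable_dens q).aestronglyMeasurable, ?_⟩
  have h : Integrable (fun x => ∑ i, |(component q i).rnDeriv (leb K) x|) (leb K) :=
    integrable_finsetSum _ fun i _ => (SignedMeasure.integrable_rnDeriv _ _).abs
  refine h.2.mono (Eventually.of_forall fun x => ?_)
  rw [Real.norm_of_nonneg (Finset.sum_nonneg fun i _ => abs_nonneg _)]
  have h1 : dens q x = ∑ i, EuclideanSpace.single i (dens q x i) := by
    ext j
    simp
  rw [h1]
  refine (norm_sum_le _ _).trans (Finset.sum_le_sum fun i _ => ?_)
  rw [PiLp.norm_single]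
  rfl

/-- Radon-Nikodym applied to each coordinate, since absolute continuity passes to the components. -/
lemma withDensityᵥ_dens {q : VectorMeasure K (E d)}
    (hq : VectorMeasure.AbsolutelyContinuous q (leb K).toENNRealVectorMeasure) :
    (leb K).withDensityᵥ (dens q) = q := by
  ext s hs i
  rw [withDensityᵥ_apply (integrable_dens q) hs]
  have hc : VectorMeasure.AbsolutelyContinuous (component q i)
      (leb K).toENNRealVectorMeasure := by
    intro t ht
    change q t i = 0
    rw [hq ht]
    rfl
  have h := congrArg (fun v : SignedMeasure K => v s)
    (SignedMeasure.withDensityᵥ_rnDeriv_eq (component q i) (leb K) hc)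
  rw [withDensityᵥ_apply (SignedMeasure.integrable_rnDeriv _ _) hs] at h
  have h2 := (EuclideanSpace.proj i : E d →L[ℝ] ℝ).integral_comp_comm
    (integrable_dens q).integrableOn (μ := (leb K).restrict s)
  exact h2.symm.trans h

lemma integral_eq_integral_dens {q : VectorMeasure K (E d)}
    (hq : VectorMeasure.AbsolutelyContinuous q (leb K).toENNRealVectorMeasure)
    {f : K → E d} (hf : StronglyMeasurable f) {C : ℝ} (hC : ∀ x, ‖f x‖ ≤ C) :
    q.integral f (innerSL ℝ) = ∫ x, inner ℝ (f x) (dens q x) ∂(leb K) := by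
  have h := integral_withDensityᵥ (integrable_dens q) hf hC
  rwa [withDensityᵥ_dens hq] at h

lemma integral_variation {q : VectorMeasure K (E d)}
    (hq : VectorMeasure.AbsolutelyContinuous q (leb K).toENNRealVectorMeasure) (w : K → ℝ) :
    ∫ x, w x ∂q.variation = ∫ x, w x * ‖dens q x‖ ∂(leb K) := by
  have h := Measure.variation_withDensityᵥ (integrable_dens q)
  rw [withDensityᵥ_dens hq] at h
  rw [h, integral_withDensity_eq_integral_toReal_smul
    (measurable_dens q).enorm (Eventually.of_forall fun x => enorm_lt_top)]
  simp [mul_comm]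

end Density

/-! ### The integrands -/

section Integrands

variable {d : ℕ} {α ε δ c : ℝ}

lemma calF_nonneg (hα : 1 < α) (hε : 0 < ε) (p : E d) : 0 ≤ calF α ε c p := by
  have h := (Real.HolderConjugate.conjExponent hα).symm.pos
  unfold calF
  positivity

lemma calF_le (hα : 1 < α) (hε : 0 < ε) (hc : 0 ≤ c) {p : E d} {C : ℝ} (hp : ‖p‖ ≤ C) :
    calF α ε c p ≤ ε / (α / (α - 1)) * (1 / ε * C) ^ (α / (α - 1)) := by
  have h : 0 ≤ α / (α - 1) := (Real.HolderConjugate.conjExponent hα).symm.nonneg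
  have h1 : max (‖p‖ - c) 0 ≤ C := max_le (by linarith) ((norm_nonneg p).trans hp)
  unfold calF
  gcongr

lemma calF_zero (hα : 1 < α) (hc : 0 ≤ c) : calF α ε c (0 : E d) = 0 := by
  have h := (Real.HolderConjugate.conjExponent hα).symm.ne_zero
  simp only [calF, norm_zero, zero_sub, max_eq_right (neg_nonpos.2 hc), mul_zero]
  change ε / α.conjExponent * (0 : ℝ) ^ α.conjExponent = 0
  rw [Real.zero_rpow h, mul_zero]

lemma calR_nonneg (hδ : 0 ≤ δ) (hc : 0 ≤ c) (p : E d) : 0 ≤ calR δ c p := by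
  have h : 0 ≤ min (‖p‖ ^ 2 / c) c := le_min (by positivity) hc
  unfold calR
  positivity

/-- Makes the Huber term vanish linearly in `δ` on bounded fields; the constant `2` is generous,
`3/2` would do. -/
lemma calR_le (hδ : 0 ≤ δ) (hc : 0 ≤ c) (p : E d) : calR δ c p ≤ δ * (‖p‖ + 2 * c) := by
  have h1 : max ‖p‖ c ≤ ‖p‖ + c := max_le (by linarith) (by linarith [norm_nonneg p])
  have h2 : min (‖p‖ ^ 2 / c) c ≤ c := min_le_right _ _
  have h3 := mul_le_mul_of_nonneg_left h1 hδ
  have h4 := mul_le_mul_of_nonneg_left h2 (div_nonneg hδ zero_le_two)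
  unfold calR
  nlinarith [mul_nonneg hδ hc]

lemma continuous_calF (hα : 1 < α) : Continuous fun z : ℝ × E d => calF α ε z.1 z.2 := by
  have h : 0 ≤ α / (α - 1) := (Real.HolderConjugate.conjExponent hα).symm.nonneg
  unfold calF
  refine continuous_const.mul (Continuous.rpow_const ?_ fun _ => Or.inr h)
  fun_prop

lemma continuous_calR : Continuous fun p : E d => calR δ c p := by
  unfold calR
  fun_prop

lemma continuous_calG (hα : 1 < α) : Continuous fun p : E d => calG α ε δ c p :=
  ((continuous_calF hα).comp (Continuous.prodMk_right c)).add continuous_calR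

lemma measurable_calG (hα : 1 < α) (p : E d) : Measurable fun c : ℝ => calG α ε δ c p := by
  refine ((continuous_calF hα).comp (Continuous.prodMk_left p)).measurable.add ?_
  unfold calR
  fun_prop

/-- The Fenchel-Young inequality for `𝓕`. -/
lemma inner_sub_calF_le (hα : 1 < α) (hε : 0 < ε) (q p : E d) :
    inner ℝ q p - calF α ε c p ≤ c * ‖q‖ + ε / α * ‖q‖ ^ α := by
  have hconj := Real.HolderConjugate.conjExponent hα
  set u := 1 / ε * max (‖p‖ - c) 0 with hu
  have hu0 : 0 ≤ u := by positivity
  have hy := Real.young_inequality_of_nonneg (norm_nonneg q) hu0 hconj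
  -- With `u` the rescaled excess of `‖p‖` over `c`, Young's inequality for the product `‖q‖ * u`,
  -- multiplied by `ε`, produces exactly the two power terms.
  have hp : ‖p‖ ≤ c + ε * u := by
    have : ε * u = max (‖p‖ - c) 0 := by rw [hu]; field_simp
    rw [this]
    linarith [le_max_left (‖p‖ - c) 0]
  have h1 : (inner ℝ q p : ℝ) ≤ ‖q‖ * (c + ε * u) :=
    (real_inner_le_norm q p).trans (mul_le_mul_of_nonneg_left hp (norm_nonneg q))
  have h2 := mul_le_mul_of_nonneg_left hy hε.le
  have h3 : calF α ε c p = ε * (u ^ α.conjExponent / α.conjExponent) := by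
    change ε / α.conjExponent * u ^ α.conjExponent = _
    ring
  have h4 : ε / α * ‖q‖ ^ α = ε * (‖q‖ ^ α / α) := by ring
  rw [h3, h4]
  nlinarith

/-- The point at which the supremum in the conjugate of `𝓕` is attained. -/
noncomputable def optimalDual (α ε c : ℝ) (q : E d) : E d := ((c + ε * ‖q‖ ^ (α - 1)) / ‖q‖) • q

/-- Only an inequality, because at `q = 0` the optimal point is `0`. -/
lemma norm_optimalDual_le (hε : 0 < ε) (hc : 0 ≤ c) (q : E d) :
    ‖optimalDual α ε c q‖ ≤ c + ε * ‖q‖ ^ (α - 1) := by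
  have h : 0 ≤ c + ε * ‖q‖ ^ (α - 1) := by positivity
  unfold optimalDual
  rw [norm_smul, Real.norm_of_nonneg (by positivity)]
  rw [div_mul_eq_mul_div]
  exact div_le_of_le_mul₀ (norm_nonneg q) h le_rfl

/-- Equality in Fenchel-Young: `p` is parallel to `q` and its excess over `c`, divided by `ε`, is
`‖q‖ ^ (α - 1)`, the equality case of Young's inequality. -/
lemma inner_optimalDual_sub_calF (hα : 1 < α) (hε : 0 < ε) (hc : 0 ≤ c) (q : E d) :
    inner ℝ (optimalDual α ε c q) q - calF α ε c (optimalDual α ε c q) =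
      c * ‖q‖ + ε / α * ‖q‖ ^ α := by
  have hconj := Real.HolderConjugate.conjExponent hα
  rcases eq_or_ne q 0 with rfl | hq
  · have h0 : optimalDual α ε c (0 : E d) = 0 := by simp [optimalDual]
    rw [h0, calF_zero hα hc]
    simp [Real.zero_rpow hconj.ne_zero]
  have hn : 0 < ‖q‖ := norm_pos_iff.2 hq
  have hu : 0 ≤ ‖q‖ ^ (α - 1) := by positivity
  have hnorm : ‖optimalDual α ε c q‖ = c + ε * ‖q‖ ^ (α - 1) := by
    unfold optimalDual
    rw [norm_smul, Real.norm_of_nonneg (by positivity), div_mul_cancel₀ _ hn.ne']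
  have hpow : (‖q‖ ^ (α - 1)) ^ (α / (α - 1)) = ‖q‖ ^ α := by
    rw [← Real.rpow_mul hn.le, mul_div_cancel₀ _ (sub_pos.2 hα).ne']
  have hF : calF α ε c (optimalDual α ε c q) = ε / (α / (α - 1)) * ‖q‖ ^ α := by
    unfold calF
    rw [hnorm, add_sub_cancel_left, max_eq_left (by positivity), ← mul_assoc,
      one_div_mul_cancel hε.ne', one_mul, hpow]
  have hin : (inner ℝ (optimalDual α ε c q) q : ℝ) = c * ‖q‖ + ε * ‖q‖ ^ α := by
    unfold optimalDual
    rw [real_inner_smul_left, real_inner_self_eq_norm_sq, Real.rpow_sub_one hn.ne']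
    field_simp
  rw [hF, hin]
  have : α ≠ 0 := hconj.ne_zero
  have : α - 1 ≠ 0 := (sub_pos.2 hα).ne'
  field_simp
  ring

lemma measurable_optimalDual {X : Type*} [MeasurableSpace X] {w : X → ℝ} {f : X → E d}
    (hw : Measurable w) (hf : Measurable f) : Measurable fun x => optimalDual α ε (w x) (f x) := by
  unfold optimalDual
  exact ((hw.add ((hf.norm.pow_const _).const_mul ε)).div hf.norm).smul hf

/-! ### The conjugate of the regularized integrand -/

lemma inner_sub_calG_le (hα : 1 < α) (hε : 0 < ε) (hδ : 0 ≤ δ) (hc : 0 ≤ c) (q p : E d) :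
    inner ℝ q p - calG α ε δ c p ≤ c * ‖q‖ + ε / α * ‖q‖ ^ α := by
  have h1 := inner_sub_calF_le (c := c) hα hε q p
  have h2 := calR_nonneg hδ hc p
  unfold calG
  linarith

/-- A real supremum over an unbounded family would be `0`, so boundedness is what lets `calGStar`
dominate its competitors. -/
lemma bddAbove_inner_sub_calG (hα : 1 < α) (hε : 0 < ε) (hδ : 0 ≤ δ) (hc : 0 ≤ c) (q : E d) :
    BddAbove (range fun p : E d => inner ℝ q p - calG α ε δ c p) :=
  ⟨_, by rintro _ ⟨p, rfl⟩; exact inner_sub_calG_le hα hε hδ hc q p⟩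

lemma calGStar_le (hα : 1 < α) (hε : 0 < ε) (hδ : 0 ≤ δ) (hc : 0 ≤ c) (q : E d) :
    calGStar α ε δ c q ≤ c * ‖q‖ + ε / α * ‖q‖ ^ α :=
  ciSup_le (inner_sub_calG_le hα hε hδ hc q)

lemma inner_sub_calG_le_calGStar (hα : 1 < α) (hε : 0 < ε) (hδ : 0 ≤ δ) (hc : 0 ≤ c)
    (q p : E d) : inner ℝ q p - calG α ε δ c p ≤ calGStar α ε δ c q :=
  le_ciSup (bddAbove_inner_sub_calG hα hε hδ hc q) p

/-- The competitor `p = 0`. The conjugate may be negative, because the Huber term does not vanish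
there when `δ` and `c` are positive. -/
lemma neg_le_calGStar (hα : 1 < α) (hε : 0 < ε) (hδ : 0 ≤ δ) (hc : 0 ≤ c) (q : E d) :
    -(δ * (2 * c)) ≤ calGStar α ε δ c q := by
  refine le_trans ?_ (inner_sub_calG_le_calGStar hα hε hδ hc q 0)
  have h := calR_le hδ hc (0 : E d)
  rw [norm_zero, zero_add] at h
  rw [calG, calF_zero hα hc, inner_zero_right]
  linarith

/-- Continuity in `p` reduces the supremum to a countable one, which makes `calGStar` measurable
along `w` and the density. -/
lemma calGStar_eq_iSup_denseSeq (hα : 1 < α) (hε : 0 < ε) (hδ : 0 ≤ δ) (hc : 0 ≤ c) (q : E d) :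
    calGStar α ε δ c q =
      ⨆ n : ℕ, (inner ℝ q (denseSeq (E d) n) - calG α ε δ c (denseSeq (E d) n)) := by
  have hb := bddAbove_inner_sub_calG (δ := δ) hα hε hδ hc q
  have hb' : BddAbove (range fun n : ℕ =>
      (inner ℝ q (denseSeq (E d) n) - calG α ε δ c (denseSeq (E d) n) : ℝ)) :=
    hb.mono (by rintro _ ⟨n, rfl⟩; exact ⟨_, rfl⟩)
  refine le_antisymm (ciSup_le fun p => ?_) (ciSup_le fun n => le_ciSup hb _)
  have hcont : Continuous fun p : E d => (inner ℝ q p - calG α ε δ c p : ℝ) :=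
    (continuous_const.inner continuous_id).sub (continuous_calG hα)
  have hcl := isClosed_le hcont (continuous_const (y := ⨆ n : ℕ,
    (inner ℝ q (denseSeq (E d) n) - calG α ε δ c (denseSeq (E d) n) : ℝ)))
  have : closure (range (denseSeq (E d))) ⊆ _ :=
    hcl.closure_subset_iff.2 (by rintro _ ⟨n, rfl⟩; exact le_ciSup hb' n)
  exact this (denseRange_denseSeq (E d) p)

lemma measurable_calGStar {X : Type*} [MeasurableSpace X] {w : X → ℝ} {f : X → E d}
    (hα : 1 < α) (hε : 0 < ε) (hδ : 0 ≤ δ) (hw : Measurable w) (hw0 : ∀ x, 0 ≤ w x)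
    (hf : Measurable f) : Measurable fun x => calGStar α ε δ (w x) (f x) := by
  simp only [calGStar_eq_iSup_denseSeq hα hε hδ (hw0 _)]
  refine Measurable.iSup fun n => ?_
  exact (hf.inner measurable_const).sub ((measurable_calG hα _).comp hw)

end Integrands

/-! ### Feasible measures -/

section Feasible

variable {d : ℕ} {K : Compacts (E d)} {α ε δ : ℝ} [Fact (1 < α)]

/-- The functional `l` in `DivEq` is forced to be `wdiv`, so what remains is a family of linear
equations against continuous fields, a form stable under weak-* limits. -/
lemma divEq_toLp_iff {f : K → E d} (h : MemLp f (ex α) (leb K)) (ν : MPerp K) :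
    DivEq h.toLp ν ↔ ∀ ψ : C1 K, -∫ x, inner ℝ (ψ.1.2 x) (f x) ∂(leb K) = ν.1 ψ := by
  have key (ψ : C1 K) : (wdiv h.toLp : WPerp K (ex' α)).1 (C1.toSobolev (ex' α) ψ) =
      -∫ x, inner ℝ (ψ.1.2 x) (f x) ∂(leb K) := by
    rw [wdiv_apply]
    refine congrArg Neg.neg (integral_congr_ae ?_)
    filter_upwards [h.coeFn_toLp, ContinuousMap.coeFn_toLp (𝕜 := ℝ) (p := ex' α) (leb K) ψ.1.2]
      with x hx hx'
    rw [hx, real_inner_comm]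
    exact congrArg (fun v => (inner ℝ v (f x) : ℝ)) hx'
  constructor
  · rintro ⟨l, hl, rfl⟩ ψ
    rw [← key, hl]
  · exact fun hψ => ⟨_, fun ψ => (key ψ).trans (hψ ψ), rfl⟩

lemma Feasible.integrable_norm_rpow {ν : MPerp K} {q : VectorMeasure K (E d)}
    (hq : Feasible α ν q) : Integrable (fun x => ‖dens q x‖ ^ α) (leb K) := by
  have hα : 0 < α := zero_lt_one.trans Fact.out
  obtain ⟨-, h, -⟩ := hq
  have := h.integrable_norm_rpow (by simpa using hα) ENNReal.ofReal_ne_top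
  rwa [ENNReal.toReal_ofReal hα.le] at this

lemma eLpNorm_toReal_rpow {f : K → E d} (h : MemLp f (ex α) (leb K)) :
    (eLpNorm f (ex α) (leb K)).toReal ^ α = ∫ x, ‖f x‖ ^ α ∂(leb K) := by
  have hα : 0 < α := zero_lt_one.trans Fact.out
  have h0 : 0 ≤ ∫ x, ‖f x‖ ^ α ∂(leb K) := integral_nonneg fun x => by positivity
  rw [h.eLpNorm_eq_integral_rpow_norm (by simpa using hα) ENNReal.ofReal_ne_top,
    ENNReal.toReal_ofReal hα.le, ENNReal.toReal_ofReal (by positivity),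
    ← Real.rpow_mul h0, inv_mul_cancel₀ hα.ne', Real.rpow_one]

variable {w : K → ℝ}

lemma integrable_mul_norm_dens (hw : Continuous w) (q : VectorMeasure K (E d)) :
    Integrable (fun x => w x * ‖dens q x‖) (leb K) := by
  obtain ⟨C, hC⟩ := isCompact_univ.exists_bound_of_continuousOn hw.continuousOn
  exact (integrable_dens q).norm.bdd_mul hw.aestronglyMeasurable
    (Eventually.of_forall fun x => hC x (mem_univ x))

lemma Feasible.integrable_energy {ν : MPerp K} {q : VectorMeasure K (E d)} (hq : Feasible α ν q)
    (hw : Continuous w) :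
    Integrable (fun x => w x * ‖dens q x‖ + ε / α * ‖dens q x‖ ^ α) (leb K) :=
  (integrable_mul_norm_dens hw q).add (hq.integrable_norm_rpow.const_mul _)

lemma Feasible.integral_energy {ν : MPerp K} {q : VectorMeasure K (E d)} (hq : Feasible α ν q)
    (hw : Continuous w) :
    ∫ x, (w x * ‖dens q x‖ + ε / α * ‖dens q x‖ ^ α) ∂(leb K) =
      (∫ x, w x ∂q.variation) + ε / α * (eLpNorm (dens q) (ex α) (leb K)).toReal ^ α := by
  rw [integral_add (integrable_mul_norm_dens hw q) (hq.integrable_norm_rpow.const_mul _),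
    integral_const_mul, integral_variation hq.1, eLpNorm_toReal_rpow hq.2.1]

lemma integrable_of_continuous {g : K → ℝ} (hg : Continuous g) : Integrable g (leb K) :=
  hg.integrable_of_hasCompactSupport (HasCompactSupport.of_compactSpace _)

/-- The integrand lies between `-(δ * (2 * w))` and the unregularized energy density. Integrability
is essential for comparing energies, as a non-integrable function has Bochner integral `0`. -/
lemma Feasible.integrable_calGStar {ν : MPerp K} {q : VectorMeasure K (E d)}
    (hq : Feasible α ν q) (hε : 0 < ε) (hδ : 0 ≤ δ) (hw : Continuous w) (hw0 : ∀ x, 0 ≤ w x) :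
    Integrable (fun x => calGStar α ε δ (w x) (dens q x)) (leb K) := by
  have hα : 1 < α := Fact.out
  have h1 := hq.integrable_energy (ε := ε) hw
  have h2 : Integrable (fun x => δ * (2 * w x)) (leb K) :=
    ((integrable_of_continuous hw).const_mul 2).const_mul δ
  refine (h1.add h2).mono'
    (measurable_calGStar hα hε hδ hw.measurable hw0 (measurable_dens q)).aestronglyMeasurable
    (Eventually.of_forall fun x => ?_)
  have h3 := calGStar_le hα hε hδ (hw0 x) (dens q x)
  have h4 := neg_le_calGStar hα hε hδ (hw0 x) (dens q x)
  have h5 : 0 ≤ w x * ‖dens q x‖ + ε / α * ‖dens q x‖ ^ α := by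
    have := hw0 x
    have : 0 < α := by linarith
    positivity
  have h6 : 0 ≤ δ * (2 * w x) := mul_nonneg hδ (by linarith [hw0 x])
  rw [Real.norm_eq_abs, abs_le]
  simp only [Pi.add_apply]
  constructor <;> linarith

lemma integrable_calF (hε : 0 < ε) (hw : Measurable w) (hw0 : ∀ x, 0 ≤ w x) {φ : K → E d}
    (hφ : Measurable φ) {C : ℝ} (hC : ∀ x, ‖φ x‖ ≤ C) :
    Integrable (fun x => calF α ε (w x) (φ x)) (leb K) := by
  have hα : 1 < α := Fact.out
  refine Integrable.of_bound
    ((continuous_calF hα).measurable.comp (hw.prodMk hφ)).aestronglyMeasurable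
    (ε / (α / (α - 1)) * (1 / ε * C) ^ (α / (α - 1))) (Eventually.of_forall fun x => ?_)
  change ‖calF α ε (w x) (φ x)‖ ≤ _
  rw [Real.norm_of_nonneg (calF_nonneg hα hε _)]
  exact calF_le hα hε (hw0 x) (hC x)

/-- The Fenchel-Young inequality for the regularized functional. -/
lemma Feasible.integral_le {ν : MPerp K} {q : VectorMeasure K (E d)} (hq : Feasible α ν q)
    (hε : 0 < ε) (hδ : 0 ≤ δ) (hw : Continuous w) (hw0 : ∀ x, 0 ≤ w x) (φ : C(K, E d)) :
    q.integral φ (innerSL ℝ) ≤ ∫ x, calGStar α ε δ (w x) (dens q x) ∂(leb K) +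
      (∫ x, calF α ε (w x) (φ x) ∂(leb K) + δ * ∫ x, (‖φ x‖ + 2 * w x) ∂(leb K)) := by
  have hα : 1 < α := Fact.out
  have hC := φ.norm_coe_le_norm
  have i1 := hq.integrable_calGStar hε hδ hw hw0
  have i2 := integrable_calF (α := α) hε hw.measurable hw0 φ.continuous.measurable hC
  have i3 : Integrable (fun x => ‖φ x‖ + 2 * w x) (leb K) :=
    integrable_of_continuous (φ.continuous.norm.add (hw.const_mul 2))
  have i4 : Integrable (fun x => (inner ℝ (φ x) (dens q x) : ℝ)) (leb K) := by
    refine ((integrable_dens q).norm.const_mul ‖φ‖).mono'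
      (φ.continuous.aestronglyMeasurable.inner (integrable_dens q).aestronglyMeasurable)
      (Eventually.of_forall fun x => ?_)
    exact (norm_inner_le_norm _ _).trans (mul_le_mul_of_nonneg_right (hC x) (norm_nonneg _))
  have i5 : Integrable (fun x => calF α ε (w x) (φ x) + δ * (‖φ x‖ + 2 * w x)) (leb K) :=
    i2.add (i3.const_mul δ)
  rw [integral_eq_integral_dens hq.1 φ.continuous.stronglyMeasurable hC, ← integral_const_mul,
    ← integral_add i2 (i3.const_mul δ), ← integral_add i1 i5]
  refine integral_mono i4 (i1.add i5) fun x => ?_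
  have h1 := inner_sub_calG_le_calGStar hα hε hδ (hw0 x) (dens q x) (φ x)
  have h2 := calR_le hδ (hw0 x) (φ x)
  rw [real_inner_comm] at h1
  rw [calG] at h1
  beta_reduce
  linarith

end Feasible

lemma tendsto_calF {ι : Type*} {l : Filter ι} {d : ℕ} {α ε : ℝ} (hα : 1 < α) (c : ℝ)
    {p : ι → E d} {p₀ : E d} (hp : Tendsto p l (𝓝 p₀)) :
    Tendsto (fun n => calF α ε c (p n)) l (𝓝 (calF α ε c p₀)) := by
  have h : Continuous fun p : E d => calF α ε c p := by
    have hα' : 0 ≤ α / (α - 1) := (Real.HolderConjugate.conjExponent hα).symm.nonneg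
    unfold calF
    refine continuous_const.mul (Continuous.rpow_const ?_ fun _ => Or.inr hα')
    fun_prop
  exact (h.tendsto p₀).comp hp

/-! ### Measures that satisfy a dual bound -/

section DualBound

variable {d : ℕ} {K : Compacts (E d)} {α ε : ℝ} [Fact (1 < α)] {w : K → ℝ}
  {q : VectorMeasure K (E d)} {M : ℝ}

/-- The dual bound for continuous fields extends to bounded measurable fields. -/
lemma integral_le_of_forall_continuous (hε : 0 < ε) (hw : Measurable w) (hw0 : ∀ x, 0 ≤ w x)
    (hM : ∀ φ : C(K, E d), q.integral φ (innerSL ℝ) ≤ M + ∫ x, calF α ε (w x) (φ x) ∂(leb K))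
    {φ : K → E d} (hφ : Measurable φ) {C : ℝ} (hC : ∀ x, ‖φ x‖ ≤ C) :
    q.integral φ (innerSL ℝ) ≤ M + ∫ x, calF α ε (w x) (φ x) ∂(leb K) := by
  have hα : 1 < α := Fact.out
  have := isFiniteMeasure_variation q
  -- At this stage `q` may still have a singular part, so convergence is required almost everywhere
  -- for the sum of both measures.
  obtain ⟨ψ, hψ, hlim⟩ := exists_continuous_tendsto_ae (m := q.variation + leb K)
    hφ.stronglyMeasurable (lt_max_of_lt_right one_pos) fun x => (hC x).trans (le_max_left C 1)
  have hl1 : ∀ᵐ x ∂q.variation, Tendsto (fun n => ψ n x) atTop (𝓝 (φ x)) :=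
    (ae_add_measure_iff.1 hlim).1
  have hl2 : ∀ᵐ x ∂(leb K), Tendsto (fun n => ψ n x) atTop (𝓝 (φ x)) :=
    (ae_add_measure_iff.1 hlim).2
  have h1 : Tendsto (fun n => q.integral (ψ n) (innerSL ℝ)) atTop
      (𝓝 (q.integral φ (innerSL ℝ))) :=
    VectorMeasure.tendsto_integral_filter_of_norm_le_const
      (Eventually.of_forall fun n => (ψ n).continuous.aestronglyMeasurable)
      ⟨_, Eventually.of_forall fun n => Eventually.of_forall (hψ n)⟩ hl1
  have h2 : Tendsto (fun n => ∫ x, calF α ε (w x) (ψ n x) ∂(leb K)) atTop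
      (𝓝 (∫ x, calF α ε (w x) (φ x) ∂(leb K))) := by
    refine tendsto_integral_of_dominated_convergence
      (fun _ => ε / (α / (α - 1)) * (1 / ε * max C 1) ^ (α / (α - 1)))
      (fun n => (integrable_calF hε hw hw0 (ψ n).continuous.measurable
        (hψ n)).aestronglyMeasurable)
      (integrable_const _) (fun n => Eventually.of_forall fun x => ?_) ?_
    · rw [Real.norm_of_nonneg (calF_nonneg hα hε _)]
      exact calF_le hα hε (hw0 x) (hψ n x)
    · filter_upwards [hl2] with x hx
      exact tendsto_calF hα (w x) hx
  exact le_of_tendsto_of_tendsto' h1 (h2.const_add M) fun n => hM (ψ n)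

/-- A measure that satisfies a dual bound is absolutely continuous. -/
lemma absolutelyContinuous_of_integral_le (hw0 : ∀ x, 0 ≤ w x)
    (hM : ∀ φ : K → E d, Measurable φ → (∃ C, ∀ x, ‖φ x‖ ≤ C) →
      q.integral φ (innerSL ℝ) ≤ M + ∫ x, calF α ε (w x) (φ x) ∂(leb K)) :
    VectorMeasure.AbsolutelyContinuous q (leb K).toENNRealVectorMeasure := by
  have hα : 1 < α := Fact.out
  have := isFiniteMeasure_variation q
  refine VectorMeasure.AbsolutelyContinuous.mk fun s hs h0 => ?_
  rw [Measure.toENNRealVectorMeasure_apply_measurable hs] at h0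
  -- The field `v` on the null set `s` and `0` elsewhere has `∫ 𝓕 = 0`. A linear function of `v`
  -- bounded above on the whole space must vanish.
  have key (v : E d) : (inner ℝ v (q s) : ℝ) ≤ M := by
    have h := hM (s.indicator fun _ => v) (measurable_const.indicator hs)
      ⟨‖v‖, fun x => norm_indicator_le_norm_self (fun _ => v) x⟩
    have hz : ∫ x, calF α ε (w x) (s.indicator (fun _ => v) x) ∂(leb K) = 0 := by
      refine integral_eq_zero_of_ae ?_
      filter_upwards [measure_eq_zero_iff_ae_notMem.1 h0] with x hx
      rw [indicator_of_notMem hx, calF_zero hα (hw0 x)]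
      rfl
    rw [hz, add_zero, VectorMeasure.integral_indicator hs] at h
    have : IsFiniteMeasure (q.restrict s).variation := inferInstance
    rw [VectorMeasure.integral_const, VectorMeasure.restrict_apply _ hs MeasurableSet.univ,
      univ_inter] at h
    exact h
  by_contra hne
  have hpos : 0 < ‖q s‖ ^ 2 := by positivity
  -- Scaled so that the inner product with `q s` equals `|M| + 1 > M`.
  have h := key (((|M| + 1) / ‖q s‖ ^ 2) • q s)
  rw [real_inner_smul_left, real_inner_self_eq_norm_sq, div_mul_cancel₀ _ hpos.ne'] at h
  linarith [le_abs_self M]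

/-- The energy of a measure that satisfies a dual bound. -/
lemma integrable_energy_of_integral_le (hε : 0 < ε) (hw : Continuous w) (hw0 : ∀ x, 0 ≤ w x)
    (hq : VectorMeasure.AbsolutelyContinuous q (leb K).toENNRealVectorMeasure)
    (hM : ∀ φ : K → E d, Measurable φ → (∃ C, ∀ x, ‖φ x‖ ≤ C) →
      q.integral φ (innerSL ℝ) ≤ M + ∫ x, calF α ε (w x) (φ x) ∂(leb K)) :
    Integrable (fun x => w x * ‖dens q x‖ + ε / α * ‖dens q x‖ ^ α) (leb K) ∧
      ∫ x, (w x * ‖dens q x‖ + ε / α * ‖dens q x‖ ^ α) ∂(leb K) ≤ M := by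
  have hα : 1 < α := Fact.out
  have hα0 : 0 < α := zero_lt_one.trans hα
  obtain ⟨W, hW⟩ := isCompact_univ.exists_bound_of_continuousOn hw.continuousOn
  have hWx (x : K) : w x ≤ W := (le_abs_self _).trans (hW x (mem_univ x))
  set f := dens q with hf
  have hfm : Measurable f := measurable_dens q
  -- The optimal dual field need not be bounded; on `A N` it is, and setting it to `0` elsewhere
  -- contributes nothing to either side of the dual bound. The resulting estimate by `M` is uniform
  -- in `N`, and these sets exhaust `K`.
  let A : ℕ → Set K := fun N => {x | ‖f x‖ ≤ N}
  have hA (N : ℕ) : MeasurableSet (A N) := measurableSet_le hfm.norm measurable_const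
  have hcover : AECover (leb K) atTop A := by
    refine ⟨Eventually.of_forall fun x => ?_, hA⟩
    obtain ⟨N, hN⟩ := exists_nat_ge ‖f x‖
    filter_upwards [eventually_ge_atTop N] with n hn
    exact hN.trans (Nat.cast_le.2 hn)
  let e : K → ℝ := fun x => w x * ‖f x‖ + ε / α * ‖f x‖ ^ α
  have he0 (x : K) : 0 ≤ e x := by
    have := hw0 x
    positivity
  have hem : Measurable e :=
    (hw.measurable.mul hfm.norm).add ((hfm.norm.pow_const α).const_mul _)
  have hbd (N : ℕ) : IntegrableOn e (A N) (leb K) := by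
    refine Measure.integrableOn_of_bounded (measure_ne_top _ _) hem.aestronglyMeasurable
      (M := W * N + ε / α * (N : ℝ) ^ α) ?_
    filter_upwards [ae_restrict_mem (hA N)] with x hx
    have hx' : ‖f x‖ ≤ N := hx
    have := hw0 x
    have := hWx x
    rw [Real.norm_of_nonneg (he0 x)]
    have h1 : w x * ‖f x‖ ≤ W * N := by gcongr; linarith
    have h2 : ε / α * ‖f x‖ ^ α ≤ ε / α * (N : ℝ) ^ α := by gcongr
    exact add_le_add h1 h2
  have hint (N : ℕ) : ∫ x in A N, e x ∂(leb K) ≤ M := by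
    let φ : K → E d := (A N).indicator fun x => optimalDual α ε (w x) (f x)
    have hφm : Measurable φ := (measurable_optimalDual hw.measurable hfm).indicator (hA N)
    have hφC (x : K) : ‖φ x‖ ≤ W + ε * (N : ℝ) ^ (α - 1) := by
      have hW0 : 0 ≤ W := (hw0 x).trans (hWx x)
      by_cases hx : x ∈ A N
      · have hx' : ‖f x‖ ≤ N := hx
        have hα1 : 0 ≤ α - 1 := by linarith
        rw [show φ x = optimalDual α ε (w x) (f x) from indicator_of_mem hx _]
        refine (norm_optimalDual_le hε (hw0 x) _).trans (add_le_add (hWx x) ?_)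
        gcongr
      · rw [show φ x = 0 from indicator_of_notMem hx _, norm_zero]
        positivity
    have h := hM φ hφm ⟨_, hφC⟩
    rw [integral_eq_integral_dens hq hφm.stronglyMeasurable hφC, ← sub_le_iff_le_add,
      ← integral_sub] at h
    · rw [← integral_indicator (hA N)]
      refine le_of_eq_of_le (integral_congr_ae (Eventually.of_forall fun x => ?_)) h
      by_cases hx : x ∈ A N
      · have h1 : φ x = optimalDual α ε (w x) (f x) := indicator_of_mem hx _
        simp only [indicator_of_mem hx, h1]
        exact (inner_optimalDual_sub_calF hα hε (hw0 x) (f x)).symm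
      · have h1 : φ x = 0 := indicator_of_notMem hx _
        simp only [indicator_of_notMem hx, h1, calF_zero hα (hw0 x), inner_zero_left, sub_zero]
    · refine ((integrable_dens q).norm.const_mul (W + ε * (N : ℝ) ^ (α - 1))).mono'
        (hφm.aestronglyMeasurable.inner hfm.aestronglyMeasurable)
        (Eventually.of_forall fun x => ?_)
      exact (norm_inner_le_norm _ _).trans (mul_le_mul_of_nonneg_right (hφC x) (norm_nonneg _))
    · exact integrable_calF hε hw.measurable hw0 hφm hφC
  have hi : Integrable e (leb K) := hcover.integrable_of_integral_bounded_of_nonneg_ae M hbd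
    (Eventually.of_forall he0) (Eventually.of_forall hint)
  exact ⟨hi, le_of_tendsto' (hcover.integral_tendsto_of_countably_generated hi) hint⟩

end DualBound

/-! ### The convergence -/

section Gamma

variable {d : ℕ} {K : Compacts (E d)} {α ε : ℝ} [Fact (1 < α)] {w : E d → ℝ} {ν : MPerp K}

lemma H_le_HZero {δ : ℝ} (hε : 0 < ε) (hδ : 0 ≤ δ) (hw : Continuous fun x : K => w x)
    (hw0 : ∀ x : K, 0 ≤ w x) (q : VectorMeasure K (E d)) : H α w ε δ ν q ≤ HZero α w ε ν q := by
  unfold H HZero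
  split_ifs with hq
  · rw [EReal.coe_le_coe_iff, ← hq.integral_energy hw]
    exact integral_mono (hq.integrable_calGStar hε hδ hw hw0) (hq.integrable_energy hw)
      fun x => calGStar_le Fact.out hε hδ (hw0 x) _
  · exact le_rfl

lemma Feasible.of_H_lt {δ M : ℝ} {q : VectorMeasure K (E d)} (h : H α w ε δ ν q < (M : EReal)) :
    Feasible α ν q ∧ ∫ x, calGStar α ε δ (w x) (dens q x) ∂(leb K) ≤ M := by
  unfold H at h
  split_ifs at h with hq
  · exact ⟨hq, (EReal.coe_lt_coe_iff.1 h).le⟩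
  · exact absurd h not_top_lt

/-- The lower bound in closed form. Frequent bounds suffice, since the dual inequality and the
divergence equations are closed conditions on the limit. -/
lemma HZero_le_of_frequently {δ : ℕ → ℝ} (hε : 0 < ε) (hδ : ∀ n, 0 < δ n)
    (hδ0 : Tendsto δ atTop (𝓝 0)) (hw : Continuous fun x : K => w x) (hw0 : ∀ x : K, 0 ≤ w x)
    {q : VectorMeasure K (E d)} {u : ℕ → VectorMeasure K (E d)} (hu : WeakStarTendsto u q) {M : ℝ}
    (hM : ∃ᶠ n in atTop, H α w ε (δ n) ν (u n) < (M : EReal)) : HZero α w ε ν q ≤ (M : EReal) := by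
  have hα : 0 < α := zero_lt_one.trans Fact.out
  have hcont (φ : C(K, E d)) :
      q.integral φ (innerSL ℝ) ≤ M + ∫ x, calF α ε (w x) (φ x) ∂(leb K) := by
    have hlim : Tendsto (fun n => (u n).integral φ (innerSL ℝ) -
        δ n * ∫ x, (‖φ x‖ + 2 * w x) ∂(leb K)) atTop (𝓝 (q.integral φ (innerSL ℝ))) := by
      simpa using (hu φ).sub (hδ0.mul_const (∫ x, (‖φ x‖ + 2 * w x) ∂(leb K)))
    refine isClosed_Iic.mem_of_frequently_of_tendsto (hM.mono fun n hn => ?_) hlim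
    obtain ⟨hq, hle⟩ := Feasible.of_H_lt hn
    have := hq.integral_le hε (hδ n).le hw hw0 φ
    rw [mem_Iic]
    linarith
  have hmeas (φ : K → E d) (hφ : Measurable φ) (hC : ∃ C, ∀ x, ‖φ x‖ ≤ C) :
      q.integral φ (innerSL ℝ) ≤ M + ∫ x, calF α ε (w x) (φ x) ∂(leb K) :=
    integral_le_of_forall_continuous hε hw.measurable hw0 hcont hφ hC.choose_spec
  have hac := absolutelyContinuous_of_integral_le hw0 hmeas
  obtain ⟨hi, hle⟩ := integrable_energy_of_integral_le hε hw hw0 hac hmeas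
  have hLp : MemLp (dens q) (ex α) (leb K) := by
    rw [← integrable_norm_rpow_iff (measurable_dens q).aestronglyMeasurable (by simpa using hα)
      ENNReal.ofReal_ne_top, ENNReal.toReal_ofReal hα.le]
    -- The term `w‖f‖` is integrable by itself, because `w` is bounded on `K`; subtracting it
    -- isolates `‖f‖ ^ α`.
    have h := (hi.sub (integrable_mul_norm_dens hw q)).const_mul (α / ε)
    refine h.congr (Eventually.of_forall fun x => ?_)
    simp only [Pi.sub_apply, add_sub_cancel_left]
    field_simp
  have hfeas : Feasible α ν q := by
    refine ⟨hac, hLp, (divEq_toLp_iff hLp ν).2 fun ψ => ?_⟩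
    have hmem : q.integral ψ.1.2 (innerSL ℝ) ∈ ({-ν.1 ψ} : Set ℝ) := by
      refine isClosed_singleton.mem_of_frequently_of_tendsto (hM.mono fun n hn => ?_) (hu ψ.1.2)
      obtain ⟨hq, -⟩ := Feasible.of_H_lt hn
      have h := (divEq_toLp_iff hq.2.1 ν).1 hq.2.2 ψ
      rw [mem_singleton_iff, integral_eq_integral_dens hq.1
        ψ.1.2.continuous.stronglyMeasurable ψ.1.2.norm_coe_le_norm]
      linarith
    rw [mem_singleton_iff, integral_eq_integral_dens hac
      ψ.1.2.continuous.stronglyMeasurable ψ.1.2.norm_coe_le_norm] at hmem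
    linarith
  rw [HZero, if_pos hfeas, EReal.coe_le_coe_iff, ← hfeas.integral_energy hw]
  exact hle

/-- `Γ`-convergence for a nonnegative continuous cost. -/
theorem gammaTendsto_H {δ : ℕ → ℝ} (hε : 0 < ε) (hδ : ∀ n, 0 < δ n)
    (hδ0 : Tendsto δ atTop (𝓝 0)) (hw : Continuous fun x : K => w x) (hw0 : ∀ x : K, 0 ≤ w x) :
    GammaTendsto WeakStarTendsto (fun n => H α w ε (δ n) ν) (HZero α w ε ν) := by
  refine ⟨fun q u hu => ?_, fun q => ⟨fun _ => q, fun φ => tendsto_const_nhds, ?_⟩⟩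
  -- Comparison with every real `M` above the lower limit also covers the value `⊤`, where there is
  -- no such `M`.
  · refine EReal.le_of_forall_lt_iff_le.1 fun M hM => ?_
    exact HZero_le_of_frequently hε hδ hδ0 hw hw0 hu (frequently_lt_of_liminf_lt (h := hM))
  · exact limsup_le_of_le (h := Eventually.of_forall fun n => H_le_HZero hε (hδ n).le hw hw0 q)

end Gamma

end Beckmann

theorem mainTheorem7 {d : ℕ} (hd : 0 < d) (α : ℝ) [Fact (1 < α)] (hα : α * ((d : ℝ) - 1) < d)
    (Ω : Compacts (Beckmann.E d))
    (hΩ : Beckmann.IsBoundedLipschitzDomain (interior (Ω : Set (Beckmann.E d))))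
    (hstar : Beckmann.IsStrictlyStarShaped (Ω : Set (Beckmann.E d)))
    (hNeumann : Beckmann.NeumannSolvable Ω α)
    (s : ℝ) (hs : 0 < s)
    (w wHat : Beckmann.E d → ℝ)
    (hw : ContinuousOn w Ω) (hw0 : ∀ x ∈ Ω, 0 ≤ w x)
    (hwHat : ContinuousOn wHat (Beckmann.dilate Ω s)) (hext : EqOn wHat w Ω)
    (hmin : sInf (wHat '' (Beckmann.dilate Ω s : Set (Beckmann.E d))) =
      sInf (w '' (Ω : Set (Beckmann.E d))))
    (ε : ℝ) (hε : 0 < ε) (ν : Beckmann.MPerp (Beckmann.dilate Ω s))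
    (δ : ℕ → ℝ) (hδ : ∀ n, 0 < δ n) (hδ0 : Tendsto δ atTop (𝓝 0)) :
    Beckmann.GammaTendsto Beckmann.WeakStarTendsto
      (fun n => Beckmann.H α wHat ε (δ n) ν) (Beckmann.HZero α wHat ε ν) := by
  -- Only the sign of `wHat` on the dilated set is left. It follows because the extension preserves
  -- the minimum, which is nonnegative on `Ω`.
  refine Beckmann.gammaTendsto_H hε hδ hδ0 hwHat.domRestrict fun x => ?_
  have hbdd : BddBelow (wHat '' (Beckmann.dilate Ω s : Set (Beckmann.E d))) :=
    ((Beckmann.dilate Ω s).isCompact.image_of_continuousOn hwHat).bddBelow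
  refine le_trans ?_ (csInf_le hbdd ⟨x, x.2, rfl⟩)
  rw [hmin]
  exact Real.sInf_nonneg (by rintro _ ⟨y, hy, rfl⟩; exact hw0 y hy)
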